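/- Consider a memoryless channel with input alphabet $\mathbb{F}_2$ and output alphabet $\mathcal{Y}$, given by transition densities (or probability masses) $P(y\mid x)$ with respect to a $\sigma$-finite reference measure $\mu$ on $\mathcal{Y}$. Suppose it is output-symmetric (BIOS): there is an involution $T$ of $\mathcal{Y}$ preserving $\mu$ with $P(y\mid 1)=P(T(y)\mid 0)$ for all $y$. Let $C=\max_{Q} I(X;Y)$ (in bits, over all distributions $Q$ of $X$) be its capacity. For a primitive polynomial $f\in\mathbb{F}_2[x]$ of degree $m$ (monic, irreducible, whose root $\alpha$ in $\mathbb{F}_{q}=\mathbb{F}_2[x]/(f)$, $q=2^m$, has order $q-1$), let $\phi:\mathbb{F}_2^m\to\mathbb{F}_{q}$, $\phi(b_0,\dots,b_{m-1})=\sum_{j} b_j\alpha^j$, applied blockwise to longer vectors. For $0<k<n\le q-1$ and exponents $0\le j_0,\dots,j_{n-1}<q-1$, the generalized Reed–Solomon code of length $n$ and dimension $k$ is $\{\boldsymbol{u}\mathbf{G}:\boldsymbol{u}\in\mathbb{F}_q^k\}$, where $\mathbf{G}$ is the $k\times n$ matrix with entries $\alpha^{j_l}\alpha^{il}$ ($0\le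 i<k$, $0\le l<n$). In its binary image, of dimension $K=km$ and length $N=nm$, a message $\boldsymbol{v}\in\mathbb{F}_2^{K}$ is encoded as $\phi^{-1}(\phi(\boldsymbol{v})\mathbf{G})\in\mathbb{F}_2^{N}$. Its frame error rate (FER) is the probability $\Pr\{\hat{\boldsymbol V}\ne\boldsymbol V\}$, where $\boldsymbol V$ is uniform on $\mathbb{F}_2^K$, its encoding is transmitted over the channel, and $\hat{\boldsymbol V}$ is the estimate of a maximum-likelihood decoder. Theorem. Let $0<R<C$. For every $\epsilon>0$ one can find, over every sufficiently large field of characteristic two, a generalized Reed–Solomon code (without any shifting vector) whose binary image satisfies $K/N\ge R$ and has FER $\le\epsilon$. Precisely: there is an $m_0$ such that for every $m\ge m_0$ primitive polynomials of degree $m$ over $\mathbb{F}_2$ exist, and for every such polynomial $f$ there are $0<k<n\le 2^m-1$ and $j_0,\dots,j_{n-1}$ such that the binary image of the corresponding code satisfies $K/N\ge R$ and has FER at most $\epsilon$ under every maximum-likelihood decoder, however ties are resolved. -/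

import Mathlib

open Polynomial MeasureTheory
open scoped NNReal ENNReal

noncomputable section

/-- `f` is a primitive polynomial over `𝔽₂`: it is monic and irreducible, and its root `α` in
`𝔽_q = 𝔽₂[x] / (f)`, with `q = 2 ^ deg f`, has multiplicative order `q - 1`, so that
`𝔽_q = {0} ∪ {α ^ i : 0 ≤ i < q - 1}`. -/
structure IsPrimitivePoly (f : (ZMod 2)[X]) : Prop where
  monic : f.Monic
  irreducible : Irreducible f
  orderOf_root : orderOf (AdjoinRoot.root f) = 2 ^ f.natDegree - 1

/-- The correspondence `φ` between `𝔽₂ ^ m` and `𝔽_q`, sending `(b₀, …, b_{m-1})` to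
`∑ j, b_j α ^ j`; its inverse `φ⁻¹` sends a field element to its binary image. -/
def bitsEquiv {f : (ZMod 2)[X]} (hf : IsPrimitivePoly f) :
    (Fin f.natDegree → ZMod 2) ≃ₗ[ZMod 2] AdjoinRoot f :=
  (AdjoinRoot.powerBasisAux' hf.monic).equivFun.symm

theorem bitsEquiv_apply {f : (ZMod 2)[X]} (hf : IsPrimitivePoly f)
    (b : Fin f.natDegree → ZMod 2) :
    bitsEquiv hf b = ∑ j, b j • AdjoinRoot.root f ^ (j : ℕ) := by
  have h : ∀ i : Fin f.natDegree,
      AdjoinRoot.powerBasisAux' hf.monic i = AdjoinRoot.root f ^ (i : ℕ) := fun i =>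
    (AdjoinRoot.powerBasis' hf.monic).basis_eq_pow i
  simp only [bitsEquiv, Module.Basis.equivFun_symm_apply, h]

/-- The `k × n` generator matrix of the generalized Reed-Solomon code with column multipliers
`α ^ j₀, …, α ^ j_{n-1}`: its entry in row `i` and column `l` is `α ^ j_l * α ^ (i l)`. -/
def grsMatrix (f : (ZMod 2)[X]) (k : ℕ) {n : ℕ} (j : Fin n → Fin (2 ^ f.natDegree - 1)) :
    Matrix (Fin k) (Fin n) (AdjoinRoot f) :=
  Matrix.of fun i l =>
    AdjoinRoot.root f ^ (j l : ℕ) * AdjoinRoot.root f ^ ((i : ℕ) * (l : ℕ))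

/-- The binary image of the encoder of the generalized Reed-Solomon (coset) code
`{u G + a : u ∈ 𝔽_q ^ k}`: the `k m` message bits `v` are read as `u = φ(v) ∈ 𝔽_q ^ k`, and the
`n m` bits `φ⁻¹(u G + a)` are sent. -/
def grsEncode {f : (ZMod 2)[X]} (hf : IsPrimitivePoly f) (k : ℕ) {n : ℕ}
    (j : Fin n → Fin (2 ^ f.natDegree - 1)) (a : Fin n → AdjoinRoot f)
    (v : Fin k × Fin f.natDegree → ZMod 2) : Fin n × Fin f.natDegree → ZMod 2 :=
  fun il => (bitsEquiv hf).symm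
    ((Matrix.vecMul (fun i => bitsEquiv hf fun t => v (i, t)) (grsMatrix f k j) + a) il.1) il.2

/-- A binary-input channel with output alphabet `Y`: for each input bit `x`, a probability density
`P(· | x)` with respect to a σ-finite reference measure on `Y`. The counting measure gives
probability mass functions, Lebesgue measure gives probability density functions. -/
structure BinaryChannel (Y : Type*) [MeasurableSpace Y] where
  ref : Measure Y
  sigmaFinite_ref : SigmaFinite ref
  density : ZMod 2 → Y → ℝ≥0
  measurable_density : ∀ x, Measurable (density x)
  lintegral_density : ∀ x, ∫⁻ y, (density x y : ℝ≥0∞) ∂ref = 1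

namespace BinaryChannel

variable {Y : Type*} [MeasurableSpace Y]

/-- Output symmetry: some involution `T` of the output alphabet (such as `y ↦ -y` on `ℝ`)
preserves the reference measure and satisfies `P(y | 1) = P(T y | 0)`. -/
def IsOutputSymmetric (W : BinaryChannel Y) : Prop :=
  ∃ T : Y → Y, Function.Involutive T ∧ MeasurePreserving T W.ref W.ref ∧
    ∀ y, W.density 1 y = W.density 0 (T y)

/-- The mutual information `I(X;Y)`, in bits, for the input distribution `Q`. -/
def mutualInfo (W : BinaryChannel Y) (Q : ZMod 2 → ℝ) : ℝ :=
  ∑ x, Q x * ∫ y, (W.density x y : ℝ) *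
    Real.logb 2 ((W.density x y : ℝ) / ∑ x', Q x' * (W.density x' y : ℝ)) ∂W.ref

/-- The channel capacity: the supremum of the mutual information over all input distributions
(it is at most one bit). -/
def capacity (W : BinaryChannel Y) : ℝ :=
  ⨆ Q : stdSimplex ℝ (ZMod 2), W.mutualInfo Q

/-- The law of the channel output when the bit `x` is sent. -/
def law (W : BinaryChannel Y) (x : ZMod 2) : Measure Y :=
  W.ref.withDensity fun y => (W.density x y : ℝ≥0∞)

instance isProbabilityMeasure_law (W : BinaryChannel Y) (x : ZMod 2) :
    IsProbabilityMeasure (W.law x) :=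
  ⟨by simp [law, W.lintegral_density x]⟩

variable {ι κ : Type*} [Fintype ι] [Fintype κ] [DecidableEq κ]

/-- The law of the output block when the block `x` is sent over the memoryless channel. -/
def blockLaw (W : BinaryChannel Y) (x : ι → ZMod 2) : Measure (ι → Y) :=
  Measure.pi fun i => W.law (x i)

/-- The likelihood `P(y | x) = ∏ i, P(y_i | x_i)`. -/
def likelihood (W : BinaryChannel Y) (x : ι → ZMod 2) (y : ι → Y) : ℝ≥0 :=
  ∏ i, W.density (x i) (y i)

/-- `dec` is a maximum-likelihood decoder for the encoder `enc`, ties being resolved in any way. -/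
def IsMLDecoder (W : BinaryChannel Y) (enc : (κ → ZMod 2) → ι → ZMod 2)
    (dec : (ι → Y) → κ → ZMod 2) : Prop :=
  ∀ y v, W.likelihood (enc v) y ≤ W.likelihood (enc (dec y)) y

/-- The frame error rate: the probability that the decoder's estimate differs from the message,
which is uniformly distributed on all bit vectors indexed by `κ`. -/
def frameErrorRate (W : BinaryChannel Y) (enc : (κ → ZMod 2) → ι → ZMod 2)
    (dec : (ι → Y) → κ → ZMod 2) : ℝ :=
  (∑ v : κ → ZMod 2, (W.blockLaw (enc v)).real {y | dec y ≠ v}) / 2 ^ Fintype.card κ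

end BinaryChannel

end

/-! The length n and dimension k stay fixed while m grows. Output symmetry gives C ≤ 1 + I, where I
≤ 0 is the mean of `logPosterior` when 0 is sent (`lt_of_lt_capacity`), so some rational k/n lies in
[R, 1 + I). By symmetry and additivity of the encoder, the error rate of any ML decoder is at most
the probability, given the zero word, that a nonzero message is at least as likely
(`frameErrorRate_le`).

This probability is averaged over all column multipliers. Multipliers fix the zero coordinates of a
codeword, so only its support S, with w = |S|, matters. On S the symbols become uniform over the
nonzero field elements, hence are dominated by uniform bits up to a factor (q/(q-1))^w ≤ 2^n
(`sum_prod_density_grsEncode_le`); this replaces a random shift. Typicality of the output is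
demanded on all nonempty supports at once: there are fewer than 2^n of them, a constant, and each
fails with probability O(1/m) by Chebyshev (`blockLaw_sum_logPosterior_le`).

The MDS property leaves at most q^(w-(n-k)) codewords with support S (`card_rsSupport_eq_le`), and
w-(n-k) ≤ w k/n: the rate seen on any support is at most k/n < 1 + I. Summing over supports, the
average probability of confusion at a typical output is at most 4^n 2^(-mη) (`sum_pow_div_rpow_le`).
Both error terms vanish as m → ∞, and some choice of multipliers does as well as the average. -/

/-! ### Existence of primitive polynomials. -/

theorem exists_isPrimitivePoly_natDegree {m : ℕ} (hm : m ≠ 0) :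
    ∃ f : (ZMod 2)[X], IsPrimitivePoly f ∧ f.natDegree = m := by
  classical
  let F := GaloisField 2 m
  have : Finite F := inferInstance
  have : Fintype F := Fintype.ofFinite F
  obtain ⟨g, hg⟩ := IsCyclic.exists_generator (α := Fˣ)
  set a : F := (g : F) with ha
  have hint : IsIntegral (ZMod 2) a := IsIntegral.of_finite _ _
  have hirr : Irreducible (minpoly (ZMod 2) a) := minpoly.irreducible hint
  -- Every nonzero element is a power of the generator `a`, so its minimal polynomial has full
  -- degree m.
  have htop : IntermediateField.adjoin (ZMod 2) {a} = ⊤ := by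
    rw [eq_top_iff]
    intro x _
    by_cases hx : x = 0
    · rw [hx]; exact zero_mem _
    · obtain ⟨z, hz⟩ := Subgroup.mem_zpowers_iff.1 (hg (Units.mk0 x hx))
      have : x = a ^ z := by rw [ha, ← Units.val_zpow_eq_zpow_val, hz]; rfl
      rw [this]
      exact zpow_mem (IntermediateField.mem_adjoin_simple_self (ZMod 2) a) z
  have hdeg : (minpoly (ZMod 2) a).natDegree = m := by
    rw [← IntermediateField.adjoin.finrank hint, htop, IntermediateField.finrank_top',
      GaloisField.finrank 2 hm]
  refine ⟨minpoly (ZMod 2) a, ⟨minpoly.monic hint, hirr, ?_⟩, hdeg⟩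
  have : Fact (Irreducible (minpoly (ZMod 2) a)) := ⟨hirr⟩
  let φ : AdjoinRoot (minpoly (ZMod 2) a) →ₐ[ZMod 2] F :=
    AdjoinRoot.liftAlgHom (minpoly (ZMod 2) a) (Algebra.ofId (ZMod 2) F) a
      (minpoly.aeval (ZMod 2) a)
  have hφ : φ (AdjoinRoot.root _) = a := AdjoinRoot.liftAlgHom_root _ _ _ _
  have hinj : Function.Injective φ := φ.toRingHom.injective
  have h1 : Nat.card Fˣ = 2 ^ m - 1 := by
    rw [Nat.card_units, GaloisField.card 2 m hm]
  have ho : orderOf (AdjoinRoot.root (minpoly (ZMod 2) a)) = orderOf a := by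
    rw [← orderOf_injective φ.toRingHom.toMonoidHom hinj]
    exact congrArg orderOf hφ
  rw [hdeg, ← h1, ← orderOf_eq_card_of_forall_mem_zpowers hg, ho, ha, orderOf_units]

/-! ### Elementary logarithmic inequalities. -/

/-- Both sides come from log t ≤ t - 1, at t = p/r and at t = r/p. This is the domination that makes
the information integrals converge. -/
theorem Real.abs_mul_log_div_le {p r A : ℝ} (hp : 0 ≤ p) (hr : 0 ≤ r) (hA : 0 ≤ A)
    (h : p ≤ A * r) : |p * Real.log (p / r)| ≤ (A ^ 2 + 1) * r := by
  rcases hp.eq_or_lt with rfl | hp'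
  · simp; positivity
  have hr' : 0 < r := by
    rcases hr.eq_or_lt with rfl | h'
    · simp at h; linarith
    · exact h'
  have h1 : Real.log (p / r) ≤ p / r - 1 := Real.log_le_sub_one_of_pos (by positivity)
  have h2 : Real.log (r / p) ≤ r / p - 1 := Real.log_le_sub_one_of_pos (by positivity)
  have h3 : Real.log (r / p) = - Real.log (p / r) := by
    rw [← Real.log_inv, inv_div]
  have h4 : p * Real.log (p / r) ≤ p * (p / r - 1) := by gcongr
  have h5 : p * Real.log (r / p) ≤ p * (r / p - 1) := by gcongr
  have h6 : p * (r / p - 1) = r - p := by field_simp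
  have h7 : p * (p / r) ≤ A ^ 2 * r := by
    rw [mul_div_assoc', div_le_iff₀ hr']
    nlinarith [mul_le_mul h h hp (by positivity)]
  rw [h3] at h5
  rw [abs_le]
  constructor <;> nlinarith [mul_nonneg (sq_nonneg A) hr]

theorem Real.logb_div_add_le_zero {p q : ℝ} (hp : 0 ≤ p) (hq : 0 ≤ q) :
    Real.logb 2 (p / (p + q)) ≤ 0 := by
  apply Real.logb_nonpos (by norm_num) (by positivity)
  exact div_le_one_of_le₀ (by linarith) (by positivity)

theorem Real.mul_logb_div_add_sq_le {p q : ℝ} (hp : 0 ≤ p) (hq : 0 ≤ q) :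
    p * Real.logb 2 (p / (p + q)) ^ 2 ≤ 4 / Real.log 2 ^ 2 * (p + q) := by
  rcases hp.eq_or_lt with rfl | hp'
  · simp; positivity
  set t := p / (p + q) with ht
  have ht0 : 0 < t := by positivity
  have ht1 : t ≤ 1 := div_le_one_of_le₀ (by linarith) (by positivity)
  have hl : 0 < Real.log 2 := Real.log_pos (by norm_num)
  -- At exponent 1/2 this reads |√t log t| < 2; squaring it produces the constant 4.
  have h := Real.abs_log_mul_self_rpow_lt t (1/2) ht0 ht1 (by norm_num)
  rw [← Real.sqrt_eq_rpow] at h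
  have h2 : (Real.log t * √t) ^ 2 ≤ 2 ^ 2 := sq_le_sq' (by linarith [(abs_lt.1 h).1])
    (by linarith [(abs_lt.1 h).2])
  rw [mul_pow, Real.sq_sqrt ht0.le] at h2
  have hpt : p = t * (p + q) := by rw [ht]; field_simp
  have hpq : 0 < p + q := by positivity
  have : p * Real.logb 2 t ^ 2 = (Real.log t ^ 2 * t) / Real.log 2 ^ 2 * (p + q) := by
    rw [Real.logb]; nth_rewrite 1 [hpt]; field_simp
  rw [this]
  gcongr
  linarith

/-! ### Information quantities of the channel and the capacity bound. -/

namespace BinaryChannel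

variable {Y : Type*} [MeasurableSpace Y] (W : BinaryChannel Y)

theorem measurable_density_coe (x : ZMod 2) : Measurable fun y => (W.density x y : ℝ) :=
  (W.measurable_density x).coe_nnreal_real

theorem integrable_density (x : ZMod 2) : Integrable (fun y => (W.density x y : ℝ)) W.ref := by
  refine ⟨(W.measurable_density_coe x).aestronglyMeasurable, ?_⟩
  rw [hasFiniteIntegral_iff_enorm]
  have : ∀ y, ‖(W.density x y : ℝ)‖ₑ = (W.density x y : ℝ≥0∞) := fun y => by
    simp [enorm]
  simp [this, W.lintegral_density x]

theorem integral_density (x : ZMod 2) : ∫ y, (W.density x y : ℝ) ∂W.ref = 1 := by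
  have h := integral_toReal (μ := W.ref) (f := fun y => (W.density x y : ℝ≥0∞))
    (W.measurable_density x).coe_nnreal_ennreal.aemeasurable (by simp)
  simpa [W.lintegral_density x] using h

theorem integral_law (x : ZMod 2) (g : Y → ℝ) :
    ∫ y, g y ∂W.law x = ∫ y, (W.density x y : ℝ) * g y ∂W.ref :=
  integral_withDensity_eq_integral_smul (W.measurable_density x) g

/-- `log₂ (P(y | 0) / (P(y | 0) + P(y | 1)))`, the logarithm of the posterior probability of the
bit `0` for the uniform input. -/
noncomputable def logPosterior (y : Y) : ℝ :=
  Real.logb 2 ((W.density 0 y : ℝ) / (W.density 0 y + W.density 1 y))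

theorem measurable_logPosterior : Measurable W.logPosterior := by
  unfold logPosterior Real.logb
  exact (Real.measurable_log.comp ((W.measurable_density_coe 0).div
    ((W.measurable_density_coe 0).add (W.measurable_density_coe 1)))).div_const _

/-- Finite second moment for every channel, since p log²(p/(p+q)) is dominated by a multiple of p +
q; this is what Chebyshev's inequality needs. -/
theorem memLp_logPosterior : MemLp W.logPosterior 2 (W.law 0) := by
  rw [memLp_two_iff_integrable_sq W.measurable_logPosterior.aestronglyMeasurable, law,
    integrable_withDensity_iff_integrable_smul (W.measurable_density 0)]
  refine Integrable.mono' (((W.integrable_density 0).add (W.integrable_density 1)).const_mul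
    (4 / Real.log 2 ^ 2)) ?_ (.of_forall fun y => ?_)
  · exact ((W.measurable_density_coe 0).mul
      (W.measurable_logPosterior.pow_const 2)).aestronglyMeasurable
  · change ‖(W.density 0 y : ℝ) * W.logPosterior y ^ 2‖ ≤ _
    rw [Real.norm_of_nonneg (by positivity)]
    exact Real.mul_logb_div_add_sq_le (by positivity) (by positivity)

theorem integrable_density_mul_logb (x : ZMod 2) {r : Y → ℝ} (hr : Measurable r)
    (hri : Integrable r W.ref) (hr0 : ∀ y, 0 ≤ r y) {A : ℝ} (hA : 0 ≤ A)
    (h : ∀ y, (W.density x y : ℝ) ≤ A * r y) :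
    Integrable (fun y => (W.density x y : ℝ) * Real.logb 2 (W.density x y / r y)) W.ref := by
  refine Integrable.mono' (hri.const_mul ((A ^ 2 + 1) / Real.log 2)) ?_ (.of_forall fun y => ?_)
  · exact ((W.measurable_density_coe x).mul ((Real.measurable_log.comp
      ((W.measurable_density_coe x).div hr)).div_const _)).aestronglyMeasurable
  · have hl : 0 < Real.log 2 := Real.log_pos (by norm_num)
    have := Real.abs_mul_log_div_le (W.density x y).coe_nonneg (hr0 y) hA (h y)
    rw [Real.norm_eq_abs, Real.logb, mul_div_assoc', abs_div, abs_of_pos hl, div_mul_eq_mul_div]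
    gcongr

theorem integral_logPosterior_nonpos : ∫ y, W.logPosterior y ∂W.law 0 ≤ 0 :=
  integral_nonpos fun _ => Real.logb_div_add_le_zero (by positivity) (by positivity)

theorem sum_univ_zmod_two {M : Type*} [AddCommMonoid M] (g : ZMod 2 → M) :
    ∑ x, g x = g 0 + g 1 := Fin.sum_univ_two g

/-- Replacing the true output density r by the uniform-input one (p₀ + p₁)/2 can only increase the
divergences, by log t ≤ t - 1 at their ratio. The last term is the linear error, which integrates to
zero. -/
theorem sum_mul_logb_le {p₀ p₁ a b : ℝ} (h₀ : 0 ≤ p₀) (h₁ : 0 ≤ p₁) (ha : 0 ≤ a) (hb : 0 ≤ b) :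
    a * (p₀ * Real.logb 2 (p₀ / (a * p₀ + b * p₁))) +
        b * (p₁ * Real.logb 2 (p₁ / (a * p₀ + b * p₁))) ≤
      a * (p₀ * (1 + Real.logb 2 (p₀ / (p₀ + p₁)))) +
        b * (p₁ * (1 + Real.logb 2 (p₁ / (p₁ + p₀)))) +
        ((p₀ + p₁) / 2 - (a * p₀ + b * p₁)) / Real.log 2 := by
  have hl : 0 < Real.log 2 := Real.log_pos (by norm_num)
  set r := a * p₀ + b * p₁ with hr
  have hr0 : 0 ≤ r := by positivity
  -- One input letter at a time. If c p = 0 both sides vanish, so r > 0 is only needed otherwise.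
  have key : ∀ c p p', 0 ≤ c → 0 ≤ p → 0 ≤ p' → (0 < c * p → 0 < r) →
      c * (p * Real.logb 2 (p / r)) ≤ c * (p * (1 + Real.logb 2 (p / (p + p')))) +
        c * p * ((p + p') / 2 / r - 1) / Real.log 2 := by
    intro c p p' hc hp hp' hcr
    rcases (mul_nonneg hc hp).eq_or_lt with h | h
    · rw [← mul_assoc, ← mul_assoc, ← h]; simp
    have hr' := hcr h
    have hp0 : 0 < p := pos_of_mul_pos_right h hc
    have hs : 0 < p + p' := by positivity
    have h1 : Real.log ((p + p') / 2 / r) ≤ (p + p') / 2 / r - 1 :=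
      Real.log_le_sub_one_of_pos (by positivity)
    rw [Real.log_div (by positivity) hr'.ne', Real.log_div hs.ne' (by norm_num)] at h1
    have h2 : Real.logb 2 (p / r) ≤ 1 + Real.logb 2 (p / (p + p')) +
        ((p + p') / 2 / r - 1) / Real.log 2 := by
      rw [Real.logb, Real.logb, Real.log_div hp0.ne' hr'.ne', Real.log_div hp0.ne' hs.ne',
        div_le_iff₀ hl, add_mul, add_mul, div_mul_cancel₀ _ hl.ne', div_mul_cancel₀ _ hl.ne']
      linarith
    calc c * (p * Real.logb 2 (p / r)) = c * p * Real.logb 2 (p / r) := by ring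
      _ ≤ c * p * (1 + Real.logb 2 (p / (p + p')) + ((p + p') / 2 / r - 1) / Real.log 2) := by
        gcongr
      _ = _ := by ring
  have k0 := key a p₀ p₁ ha h₀ h₁ (fun h => by rw [hr]; positivity)
  have k1 := key b p₁ p₀ hb h₁ h₀ (fun h => by rw [hr]; positivity)
  have h3 : a * p₀ * ((p₀ + p₁) / 2 / r - 1) / Real.log 2 +
      b * p₁ * ((p₁ + p₀) / 2 / r - 1) / Real.log 2 ≤ ((p₀ + p₁) / 2 - r) / Real.log 2 := by
    rw [← add_div]
    gcongr
    rw [add_comm p₁ p₀]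
    rcases hr0.eq_or_lt with h | h
    · rw [← h]; simp; nlinarith
    · have : a * p₀ * ((p₀ + p₁) / 2 / r - 1) + b * p₁ * ((p₀ + p₁) / 2 / r - 1) =
        r * ((p₀ + p₁) / 2 / r - 1) := by rw [hr]; ring
      rw [this, mul_sub, mul_div_cancel₀ _ h.ne', mul_one]
  linarith

theorem measurePreserving_law_add_one {W : BinaryChannel Y} {T : Y → Y} (hT : Function.Involutive T)
    (hμ : MeasurePreserving T W.ref W.ref) (hd : ∀ y, W.density 1 y = W.density 0 (T y))
    (x : ZMod 2) : MeasurePreserving T (W.law x) (W.law (x + 1)) := by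
  have hd' : ∀ y, W.density (x + 1) y = W.density x (T y) := by
    intro y
    have hx : x = 0 ∨ x = 1 := by revert x; decide
    rcases hx with rfl | rfl
    · simpa using hd y
    · rw [hd (T y), hT y]; rfl
  refine ⟨hμ.measurable, ?_⟩
  ext s hs
  rw [Measure.map_apply hμ.measurable hs, law, law, withDensity_apply _ (hμ.measurable hs),
    withDensity_apply _ hs]
  have h := hμ.setLIntegral_comp_preimage hs
    (f := fun y => (W.density (x + 1) y : ℝ≥0∞)) (W.measurable_density _).coe_nnreal_ennreal
  rw [← h]
  simp_rw [hd', hT _]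

theorem integral_density_one {W : BinaryChannel Y} {T : Y → Y} (hT : Function.Involutive T)
    (hμ : MeasurePreserving T W.ref W.ref) (hd : ∀ y, W.density 1 y = W.density 0 (T y)) :
    ∫ y, (W.density 1 y : ℝ) * Real.logb 2 ((W.density 1 y : ℝ) / (W.density 1 y + W.density 0 y))
      ∂W.ref = ∫ y, (W.density 0 y : ℝ) * W.logPosterior y ∂W.ref := by
  have hemb : MeasurableEmbedding T :=
    (MeasurableEquiv.mk ⟨T, T, hT, hT⟩ hμ.measurable hμ.measurable).measurableEmbedding
  rw [← hμ.integral_comp hemb]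
  refine integral_congr_ae (.of_forall fun y => ?_)
  simp only [logPosterior, hd, hT y]

/-- For any input law Q, the mutual information is at most the Q-average of the divergences from the
uniform-input output law. Symmetry makes these two divergences equal to 1 + I, so Q drops out. -/
theorem lt_of_lt_capacity (hW : W.IsOutputSymmetric) {R : ℝ} (hRC : R < W.capacity) :
    R < 1 + ∫ y, W.logPosterior y ∂W.law 0 := by
  obtain ⟨T, hT, hμ, hd⟩ := hW
  have : Nonempty (stdSimplex ℝ (ZMod 2)) :=
    ⟨⟨Pi.single 0 1, single_mem_stdSimplex ℝ (0 : ZMod 2)⟩⟩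
  obtain ⟨⟨Q, hQ0, hQ1⟩, hQ⟩ := exists_lt_of_lt_ciSup hRC
  refine hQ.trans_le ?_
  simp only [mutualInfo, sum_univ_zmod_two] at hQ1 ⊢
  have hsum : ∀ y, (0:ℝ) ≤ Q 0 * W.density 0 y + Q 1 * W.density 1 y := fun y =>
    add_nonneg (mul_nonneg (hQ0 0) (by positivity)) (mul_nonneg (hQ0 1) (by positivity))
  have hle : ∀ x y, Q x * W.density x y ≤ Q 0 * W.density 0 y + Q 1 * W.density 1 y := by
    intro x y
    have hx : x = 0 ∨ x = 1 := by revert x; decide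
    rcases hx with rfl | rfl
    · simpa using mul_nonneg (hQ0 1) (by positivity)
    · simpa using mul_nonneg (hQ0 0) (by positivity)
  have hi : ∀ x, Integrable (fun y => Q x * ((W.density x y : ℝ) * Real.logb 2
      ((W.density x y : ℝ) / (Q 0 * W.density 0 y + Q 1 * W.density 1 y)))) W.ref := by
    intro x
    -- A letter of probability zero contributes nothing; otherwise its density is at most 1/Q(x)
    -- times the output density.
    rcases (hQ0 x).eq_or_lt with h | h
    · simp [← h]
    · refine (W.integrable_density_mul_logb x (by
        have := W.measurable_density_coe 0
        have := W.measurable_density_coe 1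
        fun_prop) (((W.integrable_density 0).const_mul _).add
        ((W.integrable_density 1).const_mul _)) hsum (A := (Q x)⁻¹) (by positivity)
        fun y => ?_).const_mul _
      rw [inv_mul_eq_div, le_div_iff₀ h, mul_comm]
      exact hle x y
  have hj : ∀ x x', Integrable (fun y => (W.density x y : ℝ) * Real.logb 2
      ((W.density x y : ℝ) / (W.density x y + W.density x' y))) W.ref := fun x x' =>
    W.integrable_density_mul_logb x ((W.measurable_density_coe x).add (W.measurable_density_coe x'))
      ((W.integrable_density x).add (W.integrable_density x')) (fun y => by positivity)
      (A := 1) zero_le_one fun y => by simp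
  have hd0 := W.integrable_density 0
  have hd1 := W.integrable_density 1
  have hk : ∀ x x', Integrable (fun y => Q x * ((W.density x y : ℝ) * (1 + Real.logb 2
      ((W.density x y : ℝ) / (W.density x y + W.density x' y))))) W.ref := fun x x' => by
    refine Integrable.const_mul ?_ _
    simp_rw [mul_add, mul_one]
    exact (W.integrable_density x).add (hj x x')
  have hkv : ∀ x x', ∫ y, Q x * ((W.density x y : ℝ) * (1 + Real.logb 2
      ((W.density x y : ℝ) / (W.density x y + W.density x' y)))) ∂W.ref = Q x * (1 +
      ∫ y, (W.density x y : ℝ) * Real.logb 2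
      ((W.density x y : ℝ) / (W.density x y + W.density x' y)) ∂W.ref) := fun x x' => by
    rw [integral_const_mul]
    simp_rw [mul_add, mul_one]
    rw [integral_add (W.integrable_density x) (hj x x'), W.integral_density]
    ring
  have hm : Integrable (fun y => ((W.density 0 y : ℝ) + W.density 1 y) / 2) W.ref :=
    (hd0.add hd1).div_const 2
  have hn : Integrable (fun y => Q 0 * (W.density 0 y : ℝ) + Q 1 * W.density 1 y) W.ref :=
    (hd0.const_mul (Q 0)).add (hd1.const_mul (Q 1))
  have hl : Integrable (fun y => (((W.density 0 y : ℝ) + W.density 1 y) / 2 -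
      (Q 0 * W.density 0 y + Q 1 * W.density 1 y)) / Real.log 2) W.ref :=
    (hm.sub hn).div_const (Real.log 2)
  have hlv : ∫ y, (((W.density 0 y : ℝ) + W.density 1 y) / 2 -
      (Q 0 * W.density 0 y + Q 1 * W.density 1 y)) / Real.log 2 ∂W.ref = 0 := by
    rw [integral_div, integral_sub hm hn, integral_div, integral_add hd0 hd1,
      integral_add (hd0.const_mul _) (hd1.const_mul _), integral_const_mul, integral_const_mul,
      W.integral_density, W.integral_density]
    rw [mul_one, mul_one, hQ1]; norm_num
  have hkk : Integrable (fun y => Q 0 * ((W.density 0 y : ℝ) * (1 + Real.logb 2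
      ((W.density 0 y : ℝ) / (W.density 0 y + W.density 1 y)))) + Q 1 * ((W.density 1 y : ℝ) *
      (1 + Real.logb 2 ((W.density 1 y : ℝ) / (W.density 1 y + W.density 0 y))))) W.ref :=
    (hk 0 1).add (hk 1 0)
  calc _ = ∫ y, (Q 0 * ((W.density 0 y : ℝ) * Real.logb 2
        ((W.density 0 y : ℝ) / (Q 0 * W.density 0 y + Q 1 * W.density 1 y))) +
        Q 1 * ((W.density 1 y : ℝ) * Real.logb 2
        ((W.density 1 y : ℝ) / (Q 0 * W.density 0 y + Q 1 * W.density 1 y)))) ∂W.ref := by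
        rw [integral_add (hi 0) (hi 1), integral_const_mul, integral_const_mul]
        rfl
    _ ≤ _ := integral_mono ((hi 0).add (hi 1)) (hkk.add hl) fun y =>
        sum_mul_logb_le (by positivity) (by positivity) (hQ0 0) (hQ0 1)
    _ = Q 0 * (1 + ∫ y, W.logPosterior y ∂W.law 0) + Q 1 * (1 + ∫ y, W.logPosterior y ∂W.law 0) := by
        rw [integral_law]
        rw [integral_add' hkk hl, hlv, integral_add (hk 0 1) (hk 1 0), hkv, hkv,
          integral_density_one hT hμ hd, add_zero]
        rfl
    _ = _ := by rw [← add_mul, hQ1, one_mul]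

variable {ι : Type*} [Fintype ι]

/-- Chebyshev's inequality: the coordinates are independent, so variances add over `s`. -/
theorem blockLaw_sum_logPosterior_le (s : Finset ι) {δ : ℝ} (hδ : 0 < δ) (hs : s.Nonempty) :
    (W.blockLaw (0 : ι → ZMod 2)).real
        {y | ∑ i ∈ s, W.logPosterior (y i) ≤ s.card * (∫ z, W.logPosterior z ∂W.law 0 - δ)} ≤
      ProbabilityTheory.variance W.logPosterior (W.law 0) / (s.card * δ ^ 2) := by
  classical
  -- Padding with zero outside `s` turns the partial sum into a sum over all factors of the product
  -- measure.
  set X : ι → Y → ℝ := fun i => if i ∈ s then W.logPosterior else 0 with hX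
  have hXm : ∀ i, MemLp (X i) 2 (W.law ((0 : ι → ZMod 2) i)) := by
    intro i
    simp only [hX]
    split_ifs
    · exact W.memLp_logPosterior
    · exact MemLp.zero'
  have hc : (0 : ℝ) < s.card := by exact_mod_cast hs.card_pos
  have hev : ∀ i, MeasurePreserving (fun y : ι → Y => y i) (W.blockLaw (0 : ι → ZMod 2))
    (W.law 0) := fun i => measurePreserving_eval (fun i => W.law ((0 : ι → ZMod 2) i)) i
  have hsum : ∀ y : ι → Y, ∑ i ∈ s, W.logPosterior (y i) = ∑ i, X i (y i) := by
    intro y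
    have : ∀ i, X i (y i) = if i ∈ s then W.logPosterior (y i) else 0 := fun i => by
      simp only [hX]; split_ifs <;> rfl
    simp only [this, Finset.sum_ite_mem, Finset.univ_inter]
  set Z : (ι → Y) → ℝ := fun y => ∑ i ∈ s, W.logPosterior (y i) with hZ
  have hvar : ProbabilityTheory.variance Z (W.blockLaw (0 : ι → ZMod 2)) =
      s.card * ProbabilityTheory.variance W.logPosterior (W.law 0) := by
    have h := ProbabilityTheory.variance_sum_pi (μ := fun i => W.law ((0 : ι → ZMod 2) i)) hXm
    have h2 : Z = ∑ i, fun ω => X i (ω i) := by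
      ext y; simp [hZ, hsum]
    rw [h2, blockLaw, h]
    rw [Finset.sum_congr rfl (g := fun i => if i ∈ s then
      ProbabilityTheory.variance W.logPosterior (W.law 0) else 0) fun i _ => by
        simp only [hX]; split_ifs
        · rfl
        · exact ProbabilityTheory.variance_zero _]
    simp
  have hint : ∀ i, Integrable (fun y : ι → Y => W.logPosterior (y i))
      (W.blockLaw (0 : ι → ZMod 2)) := fun i =>
    (hev i).integrable_comp_of_integrable (W.memLp_logPosterior.integrable one_le_two)
  have : IsProbabilityMeasure (W.blockLaw (0 : ι → ZMod 2)) := by unfold blockLaw; infer_instance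
  have hmean : ∫ y, Z y ∂W.blockLaw (0 : ι → ZMod 2) =
      s.card * ∫ z, W.logPosterior z ∂W.law 0 := by
    simp only [hZ]
    rw [integral_finsetSum _ fun i _ => hint i]
    have : ∀ i, ∫ y, W.logPosterior (y i) ∂W.blockLaw (0 : ι → ZMod 2) =
        ∫ z, W.logPosterior z ∂W.law 0 := fun i => by
      rw [← (hev i).map_eq, integral_map (hev i).measurable.aemeasurable
        W.measurable_logPosterior.aestronglyMeasurable]
    simp [this]
  have hZm : MemLp Z 2 (W.blockLaw (0 : ι → ZMod 2)) := by
    simp only [hZ]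
    exact memLp_finsetSum _ fun i _ => W.memLp_logPosterior.comp_measurePreserving (hev i)
  have hcheb := ProbabilityTheory.meas_ge_le_variance_div_sq hZm (c := s.card * δ) (by positivity)
  rw [hvar, hmean] at hcheb
  have hV : 0 ≤ ProbabilityTheory.variance W.logPosterior (W.law 0) :=
    ProbabilityTheory.variance_nonneg _ _
  calc _ ≤ (W.blockLaw (0 : ι → ZMod 2)).real
        {y | s.card * δ ≤ |Z y - s.card * ∫ z, W.logPosterior z ∂W.law 0|} := by
        refine measureReal_mono fun y hy => ?_
        simp only [Set.mem_ofPred_eq] at hy ⊢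
        rw [le_abs]; right
        change Z y ≤ _ at hy
        linarith
    _ ≤ s.card * ProbabilityTheory.variance W.logPosterior (W.law 0) / (s.card * δ) ^ 2 :=
        ENNReal.toReal_le_of_le_ofReal (by positivity) hcheb
    _ = _ := by field_simp

end BinaryChannel

/-! ### Reduction to the zero message, and typical outputs. -/

namespace BinaryChannel

variable {Y : Type*} [MeasurableSpace Y] (W : BinaryChannel Y)
variable {ι κ : Type*} [Fintype ι] [Fintype κ]

instance isProbabilityMeasure_blockLaw (x : ι → ZMod 2) : IsProbabilityMeasure (W.blockLaw x) := by
  unfold blockLaw; infer_instance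

theorem measurable_likelihood (x : ι → ZMod 2) : Measurable (W.likelihood x) :=
  Finset.measurable_fun_prod _ fun i _ => (W.measurable_density (x i)).comp (measurable_pi_apply i)

/-- The outputs for which, when the zero message is sent, some other message is at least as
likely. -/
def confusionSet (enc : (κ → ZMod 2) → ι → ZMod 2) : Set (ι → Y) :=
  {y | ∃ v ≠ 0, W.likelihood 0 y ≤ W.likelihood (enc v) y}

theorem measurableSet_confusionSet (enc : (κ → ZMod 2) → ι → ZMod 2) :
    MeasurableSet (W.confusionSet enc) := by
  have : W.confusionSet enc =
      ⋃ v : {v : κ → ZMod 2 // v ≠ 0}, {y | W.likelihood 0 y ≤ W.likelihood (enc v) y} := by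
    ext y; simp [confusionSet]
  rw [this]
  exact .iUnion fun v => measurableSet_le (W.measurable_likelihood _) (W.measurable_likelihood _)

/-- Applying T at the positions where `enc v` is 1 carries the law for the zero word to the law for
`enc v` and translates likelihoods by `enc v`. Ties count as errors, so the bound covers every
tie-breaking rule. -/
theorem frameErrorRate_le [DecidableEq κ] (hW : W.IsOutputSymmetric) (enc : (κ → ZMod 2) →+ (ι → ZMod 2))
    {dec : (ι → Y) → κ → ZMod 2} (hdec : W.IsMLDecoder enc dec) :
    W.frameErrorRate enc dec ≤ (W.blockLaw 0).real (W.confusionSet enc) := by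
  obtain ⟨T, hT, hμ, hd⟩ := hW
  have hd' : ∀ x y, W.density x (T y) = W.density (x + 1) y := by
    intro x y
    have hx : x = 0 ∨ x = 1 := by revert x; decide
    rcases hx with rfl | rfl
    · simpa using (hd y).symm
    · rw [hd (T y), hT y]; rfl
  have key : ∀ v, (W.blockLaw (enc v)).real {y | dec y ≠ v} ≤
      (W.blockLaw 0).real (W.confusionSet enc) := by
    intro v
    set σ : (ι → Y) → (ι → Y) := fun y i => (if enc v i = 0 then id else T) (y i) with hσ
    have hσm : MeasurePreserving σ (W.blockLaw 0) (W.blockLaw (enc v)) := by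
      refine measurePreserving_pi (fun i => W.law ((0 : ι → ZMod 2) i)) _ fun i => ?_
      split_ifs with h
      · rw [h]; exact MeasurePreserving.id _
      · have h1 : enc v i = 1 := by
          revert h; generalize enc v i = x; revert x; decide
        rw [h1]; simpa using measurePreserving_law_add_one hT hμ hd 0
    have hlik : ∀ x y, W.likelihood x (σ y) = W.likelihood (x + enc v) y := by
      intro x y
      refine Finset.prod_congr rfl fun i _ => ?_
      simp only [hσ, Pi.add_apply]
      split_ifs with h
      · simp [h]
      · have h1 : enc v i = 1 := by
          revert h; generalize enc v i = x; revert x; decide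
        rw [h1, hd']
    have hset : MeasurableSet {y | ∃ v' ≠ v, W.likelihood (enc v) y ≤ W.likelihood (enc v') y} := by
      have : {y | ∃ v' ≠ v, W.likelihood (enc v) y ≤ W.likelihood (enc v') y} =
          ⋃ v' : {v' // v' ≠ v}, {y | W.likelihood (enc v) y ≤ W.likelihood (enc v') y} := by
        ext y; simp
      rw [this]
      exact .iUnion fun v => measurableSet_le (W.measurable_likelihood _)
        (W.measurable_likelihood _)
    calc _ ≤ (W.blockLaw (enc v)).real
          {y | ∃ v' ≠ v, W.likelihood (enc v) y ≤ W.likelihood (enc v') y} :=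
          -- The decoder need not be measurable: its error event is enclosed in a measurable one
          -- before changing variables.
          measureReal_mono fun y hy => ⟨dec y, hy, hdec y v⟩
      _ = (W.blockLaw 0).real
          (σ ⁻¹' {y | ∃ v' ≠ v, W.likelihood (enc v) y ≤ W.likelihood (enc v') y}) := by
          rw [← hσm.map_eq, map_measureReal_apply hσm.measurable hset]
      _ ≤ _ := by
          refine measureReal_mono ?_
          rintro y ⟨v', hv', hy⟩
          refine ⟨v' + v, ?_, ?_⟩
          · intro h
            exact hv' (by rw [eq_neg_of_add_eq_zero_left h]; ext i; simp)
          · rw [hlik, hlik] at hy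
            have : enc v + enc v = 0 := by
              ext i; exact CharTwo.add_self_eq_zero (enc v i)
            rwa [this, ← map_add] at hy
  rw [frameErrorRate, div_le_iff₀ (by positivity)]
  calc _ ≤ ∑ _v : κ → ZMod 2, (W.blockLaw 0).real (W.confusionSet enc) :=
        Finset.sum_le_sum fun v _ => key v
    _ = _ := by simp [mul_comm, ZMod.card]

theorem ae_density_pos : ∀ᵐ y ∂W.blockLaw (0 : ι → ZMod 2), ∀ i, 0 < W.density 0 (y i) := by
  rw [ae_all_iff]
  intro i
  have h : ∀ᵐ y ∂W.law 0, 0 < W.density 0 y := by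
    rw [law, ae_withDensity_iff (W.measurable_density 0).coe_nnreal_ennreal]
    exact .of_forall fun y hy => pos_iff_ne_zero.2 (by simpa using hy)
  exact (measurePreserving_eval (fun i => W.law ((0 : ι → ZMod 2) i)) i).quasiMeasurePreserving.ae h

/-- The outputs whose posterior information about a zero input block, restricted to the
coordinates in `s`, falls short of its mean by at least `δ` bits per symbol. -/
def atypicalSet {ι : Type*} (s : Finset ι) (δ : ℝ) : Set (ι → Y) :=
  {y | ∑ i ∈ s, W.logPosterior (y i) ≤ s.card * (∫ z, W.logPosterior z ∂W.law 0 - δ)}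

theorem measurableSet_atypicalSet {ι : Type*} (s : Finset ι) (δ : ℝ) :
    MeasurableSet (W.atypicalSet s δ) :=
  measurableSet_le (Finset.measurable_fun_sum _ fun i _ =>
    W.measurable_logPosterior.comp (measurable_pi_apply i)) measurable_const

theorem le_of_notMem_atypicalSet {ι : Type*} {s : Finset ι} {δ : ℝ} {y : ι → Y}
    (hy : ∀ i, 0 < W.density 0 (y i)) (h : y ∉ W.atypicalSet s δ) :
    (2 : ℝ) ^ (s.card * (∫ z, W.logPosterior z ∂W.law 0 - δ)) *
        ∏ i ∈ s, ((W.density 0 (y i) : ℝ) + W.density 1 (y i)) ≤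
      ∏ i ∈ s, (W.density 0 (y i) : ℝ) := by
  simp only [atypicalSet, Set.mem_ofPred_eq, not_le] at h
  have hy' : ∀ i, (0 : ℝ) < W.density 0 (y i) := fun i => by exact_mod_cast hy i
  have h1 : ∀ i, (W.density 0 (y i) : ℝ) =
      2 ^ W.logPosterior (y i) * ((W.density 0 (y i) : ℝ) + W.density 1 (y i)) := by
    intro i
    have := hy' i
    rw [logPosterior, Real.rpow_logb (by norm_num) (by norm_num) (by positivity)]
    field_simp
  calc _ ≤ (2 : ℝ) ^ (∑ i ∈ s, W.logPosterior (y i)) *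
        ∏ i ∈ s, ((W.density 0 (y i) : ℝ) + W.density 1 (y i)) := by
        gcongr
        norm_num
    _ = _ := by
        rw [Real.rpow_sum_of_pos (by norm_num), ← Finset.prod_mul_distrib]
        exact Finset.prod_congr rfl fun i _ => (h1 i).symm

end BinaryChannel

/-- If almost every point lies in at most `c` of finitely many measurable sets, then the
probabilities of these sets add up to at most `c`. -/
theorem sum_measureReal_le_of_ae_card_le {Ω J : Type*} [MeasurableSpace Ω] [Fintype J]
    (μ : Measure Ω) [IsProbabilityMeasure μ] {B : J → Set Ω} (hB : ∀ j, MeasurableSet (B j))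
    {c : ℝ} (h : ∀ᵐ y ∂μ, ∑ j, (B j).indicator 1 y ≤ c) : ∑ j, μ.real (B j) ≤ c := by
  have hi : ∀ j, Integrable ((B j).indicator (1 : Ω → ℝ)) μ := fun j =>
    (integrable_const 1).indicator (hB j)
  calc _ = ∫ y, ∑ j, (B j).indicator 1 y ∂μ := by
        rw [integral_finsetSum _ fun j _ => hi j]
        simp [integral_indicator_one, hB]
    _ ≤ ∫ _, c ∂μ := integral_mono_ae (integrable_finsetSum _ fun j _ => hi j)
        (integrable_const c) h
    _ = c := by simp

/-! ### Reed–Solomon words, their supports, and random column multipliers. -/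

namespace IsPrimitivePoly

theorem natDegree_pos {f : (ZMod 2)[X]} (hf : IsPrimitivePoly f) :
    0 < f.natDegree := hf.irreducible.natDegree_pos

theorem card_adjoinRoot {f : (ZMod 2)[X]} (hf : IsPrimitivePoly f) :
    Nat.card (AdjoinRoot f) = 2 ^ f.natDegree := by
  rw [← Nat.card_congr (bitsEquiv hf).toEquiv]; simp

theorem finite_adjoinRoot {f : (ZMod 2)[X]} (hf : IsPrimitivePoly f) :
    Finite (AdjoinRoot f) := Finite.of_equiv _ (bitsEquiv hf).toEquiv

theorem root_pow_injOn {f : (ZMod 2)[X]} (hf : IsPrimitivePoly f) :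
    Set.InjOn (fun i : ℕ => AdjoinRoot.root f ^ i)
    (Set.Iio (2 ^ f.natDegree - 1)) := by
  rw [← hf.orderOf_root]; exact pow_injOn_Iio_orderOf

end IsPrimitivePoly

section grs

variable {f : (ZMod 2)[X]} (hf : IsPrimitivePoly f) {k n : ℕ}

/-- The codeword `(u(1), u(α), …, u(α ^ (n - 1)))` of the Reed-Solomon code with all column
multipliers equal to one. -/
noncomputable def rsWord (k n : ℕ) (v : Fin k × Fin f.natDegree → ZMod 2) :
    Fin n → AdjoinRoot f :=
  fun l => ∑ i, bitsEquiv hf (fun t => v (i, t)) * AdjoinRoot.root f ^ ((i : ℕ) * (l : ℕ))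

theorem rsWord_add (v w : Fin k × Fin f.natDegree → ZMod 2) :
    rsWord hf k n (v + w) = rsWord hf k n v + rsWord hf k n w := by
  funext l
  simp only [rsWord, Pi.add_apply, ← Finset.sum_add_distrib, ← add_mul, ← map_add]
  rfl

theorem grsEncode_zero_apply (j : Fin n → Fin (2 ^ f.natDegree - 1))
    (v : Fin k × Fin f.natDegree → ZMod 2) (l : Fin n) (t : Fin f.natDegree) :
    grsEncode hf k j 0 v (l, t) =
      (bitsEquiv hf).symm (AdjoinRoot.root f ^ (j l : ℕ) * rsWord hf k n v l) t := by
  simp only [grsEncode, add_zero, Matrix.vecMul, dotProduct, grsMatrix, Matrix.of_apply, rsWord,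
    Finset.mul_sum]
  exact congrArg (fun z => (bitsEquiv hf).symm z t)
    (Finset.sum_congr rfl fun i _ => mul_left_comm _ _ _)

/-- The encoder of the binary image of a generalized Reed-Solomon code without shifting vector, as
an additive map. -/
noncomputable def grsEncodeHom (k : ℕ) (j : Fin n → Fin (2 ^ f.natDegree - 1)) :
    (Fin k × Fin f.natDegree → ZMod 2) →+ (Fin n × Fin f.natDegree → ZMod 2) :=
  AddMonoidHom.mk' (grsEncode hf k j 0) fun v w => by
    funext ⟨l, t⟩
    simp only [Pi.add_apply, grsEncode_zero_apply, rsWord_add, mul_add, map_add]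

/-- A polynomial of degree below k with k distinct roots is zero (Vandermonde); n ≤ q - 1 keeps the
points α^l distinct. -/
theorem eq_zero_of_rsWord_eq_zero (hn : n ≤ 2 ^ f.natDegree - 1)
    {v : Fin k × Fin f.natDegree → ZMod 2} {Z : Finset (Fin n)} (hZ : k ≤ Z.card)
    (h : ∀ l ∈ Z, rsWord hf k n v l = 0) : v = 0 := by
  have := Fact.mk hf.irreducible
  obtain ⟨Z', hZ', hk⟩ := Finset.exists_subset_card_eq hZ
  let e := Z'.equivFinOfCardEq hk
  let u : Fin k → AdjoinRoot f := fun i => bitsEquiv hf fun t => v (i, t)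
  have hinj : Function.Injective fun a : Fin k => AdjoinRoot.root f ^ (((e.symm a : Fin n)) : ℕ) := by
    intro a b hab
    have h1 := hf.root_pow_injOn (Set.mem_Iio.2 ((e.symm a : Fin n).2.trans_le hn))
      (Set.mem_Iio.2 ((e.symm b : Fin n).2.trans_le hn)) hab
    exact e.symm.injective (Subtype.ext (Fin.ext h1))
  have hu : u = 0 := by
    refine Matrix.eq_zero_of_forall_index_sum_pow_mul_eq_zero hinj fun a => ?_
    rw [← h _ (hZ' (e.symm a).2), rsWord]
    refine Finset.sum_congr rfl fun i _ => ?_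
    rw [← pow_mul, mul_comm (u i), mul_comm (i : ℕ)]
  funext ⟨i, t⟩
  have h2 : bitsEquiv hf (fun t => v (i, t)) = 0 := congrFun hu i
  rw [LinearEquiv.map_eq_zero_iff] at h2
  exact congrFun h2 t

open Classical in
/-- The support of a codeword. -/
noncomputable def rsSupport (n : ℕ) (v : Fin k × Fin f.natDegree → ZMod 2) : Finset (Fin n) :=
  {l | rsWord hf k n v l ≠ 0}

theorem mem_rsSupport {v : Fin k × Fin f.natDegree → ZMod 2} {l : Fin n} :
    l ∈ rsSupport hf n v ↔ rsWord hf k n v l ≠ 0 := by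
  simp [rsSupport]

theorem lt_card_rsSupport_add (hn : n ≤ 2 ^ f.natDegree - 1)
    {v : Fin k × Fin f.natDegree → ZMod 2} (hv : v ≠ 0) : n < (rsSupport hf n v).card + k := by
  by_contra! h
  refine hv (eq_zero_of_rsWord_eq_zero hf hn (Z := (rsSupport hf n v)ᶜ) ?_ fun l hl => ?_)
  · rw [Finset.card_compl, Fintype.card_fin]; omega
  · simpa [mem_rsSupport] using hl

/-- A word vanishing off S is determined by its values at |S| - (n - k) points of S, because these
and the complement of S make at least k positions. Truncated subtraction is harmless: if |S| ≤ n -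
k, the complement alone suffices. -/
theorem card_rsSupport_eq_le (hn : n ≤ 2 ^ f.natDegree - 1) (hk : k ≤ n) (S : Finset (Fin n)) :
    (Finset.univ.filter fun v : Fin k × Fin f.natDegree → ZMod 2 =>
      rsSupport hf n v = S).card ≤ (2 ^ f.natDegree) ^ (S.card - (n - k)) := by
  classical
  obtain ⟨S', hS', hc⟩ := Finset.exists_subset_card_eq (Nat.sub_le S.card (n - k))
  have := hf.finite_adjoinRoot
  have := Fintype.ofFinite (AdjoinRoot f)
  have hcard : Fintype.card (S' → AdjoinRoot f) = (2 ^ f.natDegree) ^ (S.card - (n - k)) := by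
    rw [Fintype.card_fun, Fintype.card_coe, hc, ← hf.card_adjoinRoot, Nat.card_eq_fintype_card]
  rw [← hcard, ← Finset.card_univ]
  refine Finset.card_le_card_of_injOn (fun v l => rsWord hf k n v l) (fun _ _ => Finset.mem_coe.2
    (Finset.mem_univ _)) fun v hv w hw hvw => ?_
  simp only [Finset.coe_filter, Finset.mem_univ, true_and, Set.mem_ofPred_eq] at hv hw
  have key : v + w = 0 := by
    refine eq_zero_of_rsWord_eq_zero hf hn (Z := Sᶜ ∪ S') ?_ fun l hl => ?_
    · have hd : Disjoint Sᶜ S' := by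
        rw [Finset.disjoint_left]; intro l hl hl'
        exact Finset.mem_compl.1 hl (hS' hl')
      have := S.card_le_univ
      rw [Finset.card_union_of_disjoint hd, Finset.card_compl, hc, Fintype.card_fin] at *
      omega
    · have hvw0 : rsWord hf k n v l = rsWord hf k n w l := by
        rcases Finset.mem_union.1 hl with hl | hl
        · have h1 : rsWord hf k n v l = 0 := by
            by_contra h; exact Finset.mem_compl.1 hl (hv ▸ (mem_rsSupport hf).2 h)
          have h2 : rsWord hf k n w l = 0 := by
            by_contra h; exact Finset.mem_compl.1 hl (hw ▸ (mem_rsSupport hf).2 h)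
          rw [h1, h2]
        · exact congrFun hvw ⟨l, hl⟩
      rw [rsWord_add, Pi.add_apply, hvw0, ← two_smul (ZMod 2)]
      have : (2 : ZMod 2) = 0 := rfl
      rw [this, zero_smul]
  funext a
  have h1 : v a + w a = 0 := congrFun key a
  exact CharTwo.add_eq_zero.1 h1

variable {Y : Type*} [MeasurableSpace Y] (W : BinaryChannel Y)

/-- Averaged over the column multipliers, the likelihood on the support of a nonzero codeword is
at most that of uniformly distributed bits, up to the factor `(q / (q - 1)) ^ w`. -/
theorem sum_prod_density_grsEncode_le (v : Fin k × Fin f.natDegree → ZMod 2)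
    (y : Fin n × Fin f.natDegree → Y) :
    ∑ j : Fin n → Fin (2 ^ f.natDegree - 1), ∏ i ∈ rsSupport hf n v ×ˢ Finset.univ,
        (W.density (grsEncode hf k j 0 v i) (y i) : ℝ) ≤
      ((2 ^ f.natDegree - 1 : ℕ) : ℝ) ^ (n - (rsSupport hf n v).card) *
        ∏ i ∈ rsSupport hf n v ×ˢ Finset.univ,
          ((W.density 0 (y i) : ℝ) + W.density 1 (y i)) := by
  classical
  have := Fact.mk hf.irreducible
  set S := rsSupport hf n v with hS
  set h : Fin n → Fin (2 ^ f.natDegree - 1) → ℝ := fun l a => if l ∈ S then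
    ∏ t, (W.density ((bitsEquiv hf).symm (AdjoinRoot.root f ^ (a : ℕ) * rsWord hf k n v l) t)
      (y (l, t)) : ℝ) else 1 with hh
  set g : Fin n → ℝ := fun l => if l ∈ S then
    ∏ t, ((W.density 0 (y (l, t)) : ℝ) + W.density 1 (y (l, t)))
    else ((2 ^ f.natDegree - 1 : ℕ) : ℝ) with hg
  have hle : ∀ l, ∑ a, h l a ≤ g l := by
    intro l
    by_cases hl : l ∈ S
    · simp only [hh, hg, if_pos hl]
      have hne := (mem_rsSupport hf).1 hl
      have hinj : Function.Injective fun a : Fin (2 ^ f.natDegree - 1) =>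
          (bitsEquiv hf).symm (AdjoinRoot.root f ^ (a : ℕ) * rsWord hf k n v l) := by
        intro a b hab
        exact Fin.ext (hf.root_pow_injOn a.2 b.2
          (mul_right_cancel₀ hne ((bitsEquiv hf).symm.injective hab)))
      calc _ = ∑ b ∈ Finset.univ.image fun a : Fin (2 ^ f.natDegree - 1) =>
            (bitsEquiv hf).symm (AdjoinRoot.root f ^ (a : ℕ) * rsWord hf k n v l),
            ∏ t, (W.density (b t) (y (l, t)) : ℝ) := by
            rw [Finset.sum_image hinj.injOn]
        -- The multiples run over distinct bit blocks; enlarging to all blocks makes the sum factor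
        -- bit by bit.
        _ ≤ ∑ b : Fin f.natDegree → ZMod 2, ∏ t, (W.density (b t) (y (l, t)) : ℝ) :=
            Finset.sum_le_sum_of_subset_of_nonneg (Finset.subset_univ _) fun _ _ _ => by positivity
        _ = _ := by
            have h01 : ∀ t, (W.density 0 (y (l, t)) : ℝ) + W.density 1 (y (l, t)) =
              ∑ x, (W.density x (y (l, t)) : ℝ) := fun t =>
                (BinaryChannel.sum_univ_zmod_two fun x => (W.density x (y (l, t)) : ℝ)).symm
            simp only [h01]
            rw [Finset.prod_univ_sum, Fintype.piFinset_univ]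
    · simp [hh, hg, hl]
  have hh0 : ∀ l a, 0 ≤ h l a := by
    intro l a; simp only [hh]; split_ifs <;> positivity
  calc _ = ∑ j : Fin n → Fin (2 ^ f.natDegree - 1), ∏ l, h l (j l) := by
        refine Finset.sum_congr rfl fun j _ => ?_
        rw [Finset.prod_product]
        simp only [hh, Finset.prod_ite_mem, Finset.univ_inter, grsEncode_zero_apply]
    _ = ∏ l, ∑ a, h l a := by
        rw [Finset.prod_univ_sum, Fintype.piFinset_univ]
    _ ≤ ∏ l, g l := Finset.prod_le_prod (fun l _ => Finset.sum_nonneg fun a _ => hh0 l a)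
        fun l _ => hle l
    _ = _ := by
        simp only [hg]
        rw [Finset.prod_ite, Finset.prod_const, Finset.prod_product, mul_comm,
          Finset.filter_univ_mem, Finset.filter_not, Finset.filter_univ_mem,
          Finset.card_univ_sdiff, Fintype.card_fin]

/-- On the support of a codeword that is at least as likely as the zero word, it is at least as
likely as the zero word, provided that the zero word has positive likelihood. -/
theorem prod_density_le_of_likelihood_le (j : Fin n → Fin (2 ^ f.natDegree - 1))
    (v : Fin k × Fin f.natDegree → ZMod 2) {y : Fin n × Fin f.natDegree → Y}
    (hy : ∀ i, 0 < W.density 0 (y i))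
    (h : W.likelihood 0 y ≤ W.likelihood (grsEncode hf k j 0 v) y) :
    ∏ i ∈ rsSupport hf n v ×ˢ Finset.univ, (W.density 0 (y i) : ℝ) ≤
      ∏ i ∈ rsSupport hf n v ×ˢ Finset.univ,
        (W.density (grsEncode hf k j 0 v i) (y i) : ℝ) := by
  classical
  set s : Finset (Fin n × Fin f.natDegree) := rsSupport hf n v ×ˢ Finset.univ with hs
  unfold BinaryChannel.likelihood at h
  rw [← Finset.prod_mul_prod_compl s, ← Finset.prod_mul_prod_compl s (fun i =>
    W.density (grsEncode hf k j 0 v i) (y i))] at h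
  -- Off the support the sent bits are zero for every choice of multipliers, so these factors
  -- cancel.
  have h1 : ∏ i ∈ sᶜ, W.density (grsEncode hf k j 0 v i) (y i) =
      ∏ i ∈ sᶜ, W.density ((0 : Fin n × Fin f.natDegree → ZMod 2) i) (y i) := by
    refine Finset.prod_congr rfl fun i hi => ?_
    obtain ⟨l, t⟩ := i
    have : rsWord hf k n v l = 0 := by
      simpa [hs, mem_rsSupport] using hi
    rw [grsEncode_zero_apply, this, mul_zero, map_zero]
    rfl
  rw [h1] at h
  have h2 := le_of_mul_le_mul_right h (Finset.prod_pos fun i _ => hy i)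
  exact_mod_cast h2

end grs

/-! ### Averaging the confusion probability over the multipliers. -/

section grs

variable {f : (ZMod 2)[X]} (hf : IsPrimitivePoly f) {k n : ℕ}

/-- The expected number of nonzero messages that beat the zero message, summed over the supports,
with `I` the information carried by one bit. -/
theorem sum_pow_div_rpow_le (hkn : k < n) (hn : n ≤ 2 ^ f.natDegree - 1) {I η : ℝ} (hη : 0 ≤ η)
    (hI : k / n + η ≤ 1 + I) :
    ∑ v : Fin k × Fin f.natDegree → ZMod 2 with v ≠ 0,
        ((2 ^ f.natDegree - 1 : ℕ) : ℝ) ^ (n - (rsSupport hf n v).card) /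
          (2 : ℝ) ^ (((rsSupport hf n v).card * f.natDegree : ℕ) * I) ≤
      ((2 ^ f.natDegree - 1 : ℕ) : ℝ) ^ n * (4 ^ n * 2 ^ (-(f.natDegree * η))) := by
  classical
  set m := f.natDegree with hm
  have hm0 : 0 < m := hf.natDegree_pos
  -- Gives (q/(q-1))^w ≤ 2^w ≤ 2^n; the other factor 2^n in 4^n counts the supports.
  have hq2 : 2 ^ m ≤ (2 ^ m - 1) * 2 := by
    have := Nat.one_lt_two_pow hm0.ne'
    omega
  have hq0 : (0 : ℝ) < ((2 ^ m - 1 : ℕ) : ℝ) := by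
    have := Nat.one_lt_two_pow hm0.ne'
    exact_mod_cast Nat.sub_pos_of_lt this
  have hn0 : (0 : ℝ) < n := by exact_mod_cast (Nat.zero_le k).trans_lt hkn
  set F : Finset (Fin n) → ℝ := fun S => ((2 ^ m - 1 : ℕ) : ℝ) ^ (n - S.card) /
          (2 : ℝ) ^ ((S.card * m : ℕ) * I) with hF
  have hF0 : ∀ S, 0 ≤ F S := fun S => by positivity
  have key : ∀ S : Finset (Fin n), ∑ v ∈ (Finset.univ.filter fun v :
      Fin k × Fin m → ZMod 2 => v ≠ 0) with rsSupport hf n v = S, F (rsSupport hf n v) ≤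
      ((2 ^ m - 1 : ℕ) : ℝ) ^ n * (2 ^ n * 2 ^ (-(m * η))) := by
    intro S
    rcases Finset.eq_empty_or_nonempty ((Finset.univ.filter fun v :
      Fin k × Fin m → ZMod 2 => v ≠ 0).filter fun v => rsSupport hf n v = S) with h | ⟨v, hv⟩
    · rw [h, Finset.sum_empty]; positivity
    simp only [Finset.mem_filter, Finset.mem_univ, true_and] at hv
    have hw := lt_card_rsSupport_add hf hn hv.1
    rw [hv.2] at hw
    have hwn : S.card ≤ n := by simpa using S.card_le_univ
    set w := S.card with hwdef
    have hcard : (((Finset.univ.filter fun v :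
      Fin k × Fin m → ZMod 2 => v ≠ 0).filter fun v => rsSupport hf n v = S).card : ℝ) ≤
        ((2 ^ m) ^ (w - (n - k)) : ℝ) := by
      have h1 := card_rsSupport_eq_le hf hn hkn.le S
      have h2 := (Finset.card_le_card (Finset.filter_subset_filter (fun v =>
        rsSupport hf n v = S) (Finset.filter_subset (fun v : Fin k × Fin m → ZMod 2 => v ≠ 0)
        Finset.univ))).trans h1
      exact_mod_cast h2
    rw [Finset.sum_congr rfl (g := fun _ => F S) fun v hv => by
      rw [(Finset.mem_filter.1 hv).2], Finset.sum_const, nsmul_eq_mul]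
    have h3 : ((2 ^ m - 1 : ℕ) : ℝ) ^ (n - w) ≤
        ((2 ^ m - 1 : ℕ) : ℝ) ^ n * (2 ^ n / (2 ^ m) ^ w) := by
      rw [mul_div_assoc', le_div_iff₀ (by positivity)]
      have h4 : ((2 : ℝ) ^ m) ^ w ≤ ((2 ^ m - 1 : ℕ) : ℝ) ^ w * 2 ^ w := by
        rw [← mul_pow]
        gcongr
        exact_mod_cast hq2
      calc _ ≤ ((2 ^ m - 1 : ℕ) : ℝ) ^ (n - w) * (((2 ^ m - 1 : ℕ) : ℝ) ^ w * 2 ^ w) := by gcongr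
        _ = ((2 ^ m - 1 : ℕ) : ℝ) ^ n * 2 ^ w := by
          rw [← mul_assoc, ← pow_add, Nat.sub_add_cancel hwn]
        _ ≤ _ := by gcongr; norm_num
    -- Since w ≤ n, w - (n - k) ≤ w k/n, so the exponent is at most -m w η, and w ≥ 1.
    have hexp : (m : ℝ) * (w - (n - k)) - m * w - w * m * I ≤ -(m * η) := by
      have hw1 : (1 : ℝ) ≤ w := by exact_mod_cast (by omega : 1 ≤ w)
      have hwn' : (w : ℝ) ≤ n := by exact_mod_cast hwn
      have h5 : (w : ℝ) - (n - k) ≤ w * (k / n) := by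
        have h6 : (k : ℝ) ≤ n := by exact_mod_cast hkn.le
        rw [mul_div_assoc', le_div_iff₀ hn0]
        nlinarith [mul_nonneg (sub_nonneg.2 hwn') (sub_nonneg.2 h6)]
      have h7 : (w : ℝ) * (k / n + η) ≤ w * (1 + I) := by gcongr
      have h8 : η ≤ w * η := le_mul_of_one_le_left hη hw1
      have h9 : (w : ℝ) - (n - k) - w - w * I ≤ -η := by linarith
      have hm' : (0 : ℝ) ≤ m := by positivity
      nlinarith [mul_le_mul_of_nonneg_left h9 hm']
    calc _ ≤ ((2 : ℝ) ^ m) ^ (w - (n - k)) * (((2 ^ m - 1 : ℕ) : ℝ) ^ n * (2 ^ n / (2 ^ m) ^ w) /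
          (2 : ℝ) ^ ((w * m : ℕ) * I)) := by
          simp only [hF]
          gcongr
      _ = ((2 ^ m - 1 : ℕ) : ℝ) ^ n * (2 ^ n * (((2 : ℝ) ^ m) ^ (w - (n - k)) / (2 ^ m) ^ w /
          (2 : ℝ) ^ ((w * m : ℕ) * I))) := by ring
      _ = ((2 ^ m - 1 : ℕ) : ℝ) ^ n * (2 ^ n * (2 : ℝ) ^
          ((m : ℝ) * (w - (n - k)) - m * w - w * m * I)) := by
          rw [← pow_mul, ← pow_mul, Real.rpow_sub two_pos, Real.rpow_sub two_pos,
            ← Real.rpow_natCast 2 (m * (w - (n - k))), ← Real.rpow_natCast 2 (m * w)]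
          push_cast [Nat.cast_sub (by omega : n - k ≤ w), Nat.cast_sub hkn.le]
          rfl
      _ ≤ _ := by gcongr; norm_num
  calc _ = ∑ S, ∑ v ∈ (Finset.univ.filter fun v :
      Fin k × Fin m → ZMod 2 => v ≠ 0) with rsSupport hf n v = S, F (rsSupport hf n v) :=
        (Finset.sum_fiberwise _ _ _).symm
    _ ≤ ∑ _S : Finset (Fin n), ((2 ^ m - 1 : ℕ) : ℝ) ^ n * (2 ^ n * 2 ^ (-(m * η))) :=
        Finset.sum_le_sum fun S _ => key S
    _ = _ := by
        rw [Finset.sum_const, Finset.card_univ, Fintype.card_finset, Fintype.card_fin, nsmul_eq_mul,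
          show (4 : ℝ) = 2 * 2 by norm_num, mul_pow]
        push_cast
        ring

variable {Y : Type*} [MeasurableSpace Y] (W : BinaryChannel Y)

/-- Atypical outputs are removed first, by one event serving all multipliers. On the rest, the
indicator of confusion is bounded by a sum of likelihood ratios, which is averaged pointwise in the
output. -/
theorem sum_measureReal_confusionSet_le (hkn : k < n) (hn : n ≤ 2 ^ f.natDegree - 1) {δ η : ℝ}
    (hδ : 0 < δ) (hη : 0 ≤ η) (hI : k / n + η ≤ 1 + (∫ y, W.logPosterior y ∂W.law 0 - δ)) :
    ∑ j : Fin n → Fin (2 ^ f.natDegree - 1),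
        (W.blockLaw 0).real (W.confusionSet (grsEncode hf k j 0)) ≤
      ((2 ^ f.natDegree - 1 : ℕ) : ℝ) ^ n *
        (2 ^ n * (ProbabilityTheory.variance W.logPosterior (W.law 0) / (f.natDegree * δ ^ 2)) +
          4 ^ n * 2 ^ (-(f.natDegree * η))) := by
  classical
  set m := f.natDegree with hm
  have hm0 : 0 < m := hf.natDegree_pos
  have : Nonempty (Fin m) := ⟨⟨0, hm0⟩⟩
  have hm0' : (0 : ℝ) < m := by exact_mod_cast hm0
  set V := ProbabilityTheory.variance W.logPosterior (W.law 0) with hV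
  have hV0 : 0 ≤ V := ProbabilityTheory.variance_nonneg _ _
  set I := ∫ y, W.logPosterior y ∂W.law 0 - δ with hIdef
  set P := W.blockLaw (0 : Fin n × Fin m → ZMod 2) with hP
  set U : Set (Fin n × Fin m → Y) := ⋃ S ∈ (Finset.univ.filter fun S : Finset (Fin n) =>
    S.Nonempty), W.atypicalSet (S ×ˢ Finset.univ) δ with hU
  have hUm : MeasurableSet U := Finset.measurableSet_biUnion _ fun S _ =>
    W.measurableSet_atypicalSet _ _
  have hUP : P.real U ≤ 2 ^ n * (V / (m * δ ^ 2)) := by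
    calc _ ≤ ∑ S ∈ (Finset.univ.filter fun S : Finset (Fin n) => S.Nonempty),
          P.real (W.atypicalSet (S ×ˢ Finset.univ) δ) := measureReal_biUnion_finset_le _ _
      _ ≤ ∑ S ∈ (Finset.univ.filter fun S : Finset (Fin n) => S.Nonempty), V / (m * δ ^ 2) := by
          refine Finset.sum_le_sum fun S hS => ?_
          have hS' := (Finset.mem_filter.1 hS).2
          refine (W.blockLaw_sum_logPosterior_le _ hδ
            (hS'.product Finset.univ_nonempty)).trans ?_
          have h1 : (1 : ℝ) ≤ S.card := by exact_mod_cast hS'.card_pos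
          rw [Finset.card_product, Finset.card_univ, Fintype.card_fin]
          push_cast
          gcongr
          exact le_mul_of_one_le_left hm0'.le h1
      _ ≤ ∑ _S : Finset (Fin n), V / (m * δ ^ 2) :=
          Finset.sum_le_sum_of_subset_of_nonneg (Finset.filter_subset _ _) fun _ _ _ => by
            positivity
      _ = _ := by simp
  set B : (Fin n → Fin (2 ^ m - 1)) → Set (Fin n × Fin m → Y) := fun j =>
    W.confusionSet (grsEncode hf k j 0) with hB
  have hBm : ∀ j, MeasurableSet (B j) := fun j => W.measurableSet_confusionSet _
  have hmain : ∑ j, P.real (B j \ U) ≤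
      ((2 ^ m - 1 : ℕ) : ℝ) ^ n * (4 ^ n * 2 ^ (-(m * η))) := by
    refine sum_measureReal_le_of_ae_card_le P (fun j => (hBm j).diff hUm) ?_
    filter_upwards [W.ae_density_pos] with y hy
    by_cases hyU : y ∈ U
    · rw [Finset.sum_eq_zero fun j _ => Set.indicator_of_notMem (fun h => h.2 hyU) _]
      positivity
    set s : (Fin k × Fin m → ZMod 2) → Finset (Fin n × Fin m) := fun v =>
      rsSupport hf n v ×ˢ Finset.univ with hs
    -- A lower bound, at typical outputs, for the likelihood of the zero word on the support of `v`.
    -- It does not depend on the multipliers, so it comes out of the average.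
    set D : (Fin k × Fin m → ZMod 2) → ℝ := fun v =>
      (2 : ℝ) ^ (((rsSupport hf n v).card * m : ℕ) * I) *
        ∏ i ∈ s v, ((W.density 0 (y i) : ℝ) + W.density 1 (y i)) with hD
    have hy' : ∀ i, (0 : ℝ) < (W.density 0 (y i) : ℝ) + W.density 1 (y i) := fun i =>
      add_pos_of_pos_of_nonneg (by exact_mod_cast hy i) (by positivity)
    have hD0 : ∀ v, 0 < D v := fun v =>
      mul_pos (by positivity) (Finset.prod_pos fun i _ => hy' i)
    have hDle : ∀ v ≠ 0, D v ≤ ∏ i ∈ s v, (W.density 0 (y i) : ℝ) := by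
      intro v hv
      have hne : (rsSupport hf n v).Nonempty := by
        have := lt_card_rsSupport_add hf hn hv
        exact Finset.card_pos.1 (by omega)
      have hnot : y ∉ W.atypicalSet (s v) δ := fun h => hyU
        (Set.mem_biUnion (Finset.mem_coe.2 (Finset.mem_filter.2 ⟨Finset.mem_univ _, hne⟩)) h)
      have := W.le_of_notMem_atypicalSet hy hnot
      simpa only [hD, hs, Finset.card_product, Finset.card_univ, Fintype.card_fin] using this
    calc ∑ j, (B j \ U).indicator 1 y
        ≤ ∑ j, ∑ v : Fin k × Fin m → ZMod 2 with v ≠ 0,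
          (∏ i ∈ s v, (W.density (grsEncode hf k j 0 v i) (y i) : ℝ)) / D v := by
          refine Finset.sum_le_sum fun j _ => ?_
          have hnn : ∀ v, 0 ≤ (∏ i ∈ s v, (W.density (grsEncode hf k j 0 v i) (y i) : ℝ)) / D v :=
            fun v => div_nonneg (by positivity) (hD0 v).le
          by_cases hyB : y ∈ B j \ U
          · obtain ⟨v, hv, hle⟩ := hyB.1
            rw [Set.indicator_of_mem hyB, Pi.one_apply]
            refine le_trans ?_ (Finset.single_le_sum (fun v _ => hnn v)
              (Finset.mem_filter.2 ⟨Finset.mem_univ v, hv⟩))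
            rw [le_div_iff₀ (hD0 v), one_mul]
            exact (hDle v hv).trans (prod_density_le_of_likelihood_le hf W j v hy hle)
          · rw [Set.indicator_of_notMem hyB]
            exact Finset.sum_nonneg fun v _ => hnn v
      _ = ∑ v : Fin k × Fin m → ZMod 2 with v ≠ 0,
          (∑ j, ∏ i ∈ s v, (W.density (grsEncode hf k j 0 v i) (y i) : ℝ)) / D v := by
          rw [Finset.sum_comm]
          simp only [Finset.sum_div]
      _ ≤ ∑ v : Fin k × Fin m → ZMod 2 with v ≠ 0,
          ((2 ^ m - 1 : ℕ) : ℝ) ^ (n - (rsSupport hf n v).card) /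
          (2 : ℝ) ^ (((rsSupport hf n v).card * m : ℕ) * I) := by
          refine Finset.sum_le_sum fun v _ => ?_
          rw [div_le_iff₀ (hD0 v)]
          refine (sum_prod_density_grsEncode_le hf W v y).trans_eq ?_
          simp only [hD]
          have : (0 : ℝ) < (2 : ℝ) ^ (((rsSupport hf n v).card * m : ℕ) * I) := by positivity
          rw [← mul_assoc, div_mul_cancel₀ _ this.ne']
      _ ≤ _ := sum_pow_div_rpow_le hf hkn hn hη hI
  calc ∑ j, P.real (B j) ≤ ∑ j, (P.real U + P.real (B j \ U)) := by
        refine Finset.sum_le_sum fun j _ => ?_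
        refine (measureReal_mono (s₂ := U ∪ B j \ U) ?_).trans (measureReal_union_le _ _)
        rw [Set.union_sdiff_self]
        exact Set.subset_union_right
    _ = ((2 ^ m - 1 : ℕ) : ℝ) ^ n * P.real U + ∑ j, P.real (B j \ U) := by
        rw [Finset.sum_add_distrib, Finset.sum_const, Finset.card_univ, Fintype.card_fun,
          Fintype.card_fin, Fintype.card_fin, nsmul_eq_mul, Nat.cast_pow]
    _ ≤ _ := by
        rw [mul_add]
        gcongr

end grs

/-! ### Choice of the parameters and conclusion. -/

theorem exists_nat_div_between {R C : ℝ} (hR : 0 < R) (hRC : R < C) (hC : C ≤ 1) :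
    ∃ n k : ℕ, 0 < k ∧ k < n ∧ R ≤ (k : ℝ) / n ∧ (k : ℝ) / n < C := by
  obtain ⟨r, hr1, hr2⟩ := exists_rat_btwn hRC
  have hr0 : 0 < r := by exact_mod_cast hR.trans hr1
  have hnum : ((r.num.toNat : ℤ)) = r.num := Int.toNat_of_nonneg (Rat.num_pos.2 hr0).le
  have hval : ((r.num.toNat : ℝ)) / r.den = r := by
    have : (r.num.toNat : ℝ) = (r.num : ℝ) := by exact_mod_cast hnum
    rw [this, ← Rat.cast_def]
  have hden : (0 : ℝ) < r.den := by exact_mod_cast r.den_pos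
  refine ⟨r.den, r.num.toNat, ?_, ?_, by rw [hval]; exact hr1.le, by rwa [hval]⟩
  · have := Rat.num_pos.2 hr0
    omega
  · have h1 : ((r.num.toNat : ℝ)) / r.den < 1 := by rw [hval]; linarith
    rw [div_lt_one hden] at h1
    exact_mod_cast h1

theorem theorem2 {Y : Type*} [MeasurableSpace Y] (W : BinaryChannel Y)
    (hW : W.IsOutputSymmetric) (R : ℝ) (hR : 0 < R) (hRC : R < W.capacity)
    (ε : ℝ) (hε : 0 < ε) :
    ∃ m₀ : ℕ, ∀ m : ℕ, m₀ ≤ m →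
      (∃ f : (ZMod 2)[X], IsPrimitivePoly f ∧ f.natDegree = m) ∧
      ∀ (f : (ZMod 2)[X]) (hf : IsPrimitivePoly f), f.natDegree = m →
        ∃ (n k : ℕ) (j : Fin n → Fin (2 ^ f.natDegree - 1)),
          0 < k ∧ k < n ∧ n ≤ 2 ^ m - 1 ∧
          R ≤ ((k * m : ℕ) : ℝ) / ((n * m : ℕ) : ℝ) ∧
          ∀ dec : (Fin n × Fin f.natDegree → Y) → Fin k × Fin f.natDegree → ZMod 2,
            W.IsMLDecoder (grsEncode hf k j 0) dec →
              W.frameErrorRate (grsEncode hf k j 0) dec ≤ ε := by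
  have hI := W.lt_of_lt_capacity hW hRC
  set I := ∫ y, W.logPosterior y ∂W.law 0 with hIdef
  obtain ⟨n, k, hk0, hkn, hRk, hkI⟩ := exists_nat_div_between hR hI
    (by linarith [W.integral_logPosterior_nonpos])
  -- Half the gap is the typicality slack, the other half the exponent η: k/n + δ = 1 + I - δ.
  set δ := (1 + I - k / n) / 2 with hδ
  have hδ0 : 0 < δ := by rw [hδ]; linarith
  set V := ProbabilityTheory.variance W.logPosterior (W.law 0) with hV
  have hlim : Filter.Tendsto (fun m : ℕ => 2 ^ n * (V / (m * δ ^ 2)) + 4 ^ n * 2 ^ (-(m * δ)))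
      Filter.atTop (nhds (2 ^ n * 0 + 4 ^ n * 0)) := by
    refine (Filter.Tendsto.const_mul _ ?_).add (Filter.Tendsto.const_mul _ ?_)
    · exact Filter.Tendsto.const_div_atTop
        (tendsto_natCast_atTop_atTop.atTop_mul_const (by positivity)) V
    · have h1 : ∀ m : ℕ, (2 : ℝ) ^ (-(m * δ)) = (2 ^ (-δ)) ^ m := fun m => by
        rw [← Real.rpow_mul_natCast (by norm_num)]; congr 1; ring
      simp only [h1]
      exact tendsto_pow_atTop_nhds_zero_of_lt_one (by positivity)
        (Real.rpow_lt_one_of_one_lt_of_neg one_lt_two (by linarith))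
  rw [mul_zero, mul_zero, add_zero] at hlim
  obtain ⟨m₁, hm₁⟩ := Filter.eventually_atTop.1 (hlim.eventually_le_const hε)
  -- m ≥ n + 1 ensures both m ≠ 0 and n ≤ 2^m - 1.
  refine ⟨max m₁ (n + 1), fun m hm => ⟨exists_isPrimitivePoly_natDegree (by omega), ?_⟩⟩
  intro f hf hfm
  subst hfm
  have hmn : n + 1 ≤ f.natDegree := (le_max_right _ _).trans hm
  have hn : n ≤ 2 ^ f.natDegree - 1 := by
    have := Nat.lt_two_pow_self (n := f.natDegree)
    omega
  have hsum := sum_measureReal_confusionSet_le hf W hkn hn hδ0 hδ0.le (by rw [hδ]; linarith)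
  have hq : 0 < 2 ^ f.natDegree - 1 := by omega
  have : Nonempty (Fin (2 ^ f.natDegree - 1)) := ⟨⟨0, hq⟩⟩
  obtain ⟨j, -, hj⟩ := Finset.exists_le_of_sum_le
    (s := (Finset.univ : Finset (Fin n → Fin (2 ^ f.natDegree - 1)))) (g := fun _ => ε)
    Finset.univ_nonempty (hsum.trans (by
      rw [Finset.sum_const, Finset.card_univ, Fintype.card_fun, Fintype.card_fin, Fintype.card_fin,
        nsmul_eq_mul, Nat.cast_pow]
      gcongr
      exact hm₁ _ ((le_max_left _ _).trans hm)))
  refine ⟨n, k, j, hk0, hkn, hn, ?_, fun dec hdec => ?_⟩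
  · push_cast
    rwa [mul_div_mul_right]
    exact_mod_cast hf.natDegree_pos.ne'
  · exact (W.frameErrorRate_le hW (grsEncodeHom hf k j) hdec).trans hj
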